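/- Let $d \ge 2$, let $\rho \in [0,1)$ and let $Q$ be a $d\times d$ real orthogonal matrix. Let $S^{d-1}=\{x\in\mathbb{R}^d : \|x\|=1\}$ and let $A_{d-1}=2\pi^{d/2}/\Gamma(d/2)$ be its surface area. Suppose that the random vector $(U,V)$ with values in $S^{d-1}\times S^{d-1}$ has density $$c(u,v)=\frac{1}{A_{d-1}^2}\,\frac{1-\rho^2}{(1-2\rho\,u'Qv+\rho^2)^{d/2}},\qquad u,v\in S^{d-1},$$ with respect to the product of the surface measures (vectors are columns and $x'$ denotes the transpose of $x$). Then $$E(U)=E(V)=0,\qquad E(UU')=E(VV')=d^{-1}I,\qquad E(UV')=d^{-1}\rho\,Q,$$ where all these expectations exist. Consequently, with $\Sigma_{UU}=E(UU')-E(U)E(U')$, $\Sigma_{UV}=E(UV')-E(U)E(V')$ and $\Sigma_{VV}=E(VV')-E(V)E(V')$, the matrices $\Sigma_{UU}$ and $\Sigma_{VV}$ are invertible, the matrix $\Sigma_{UU}^{-1}\Sigma_{UV}\Sigma_{VV}^{-1}\Sigma_{UV}'$ has a largest real eigenvalue $\lambda$, and the Johnson–Wehrly coefficient of correlation $\rho_{JW}=\lambda^{1/2}$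 equals $\rho$. -/

import Mathlib

open MeasureTheory ProbabilityTheory
open scoped Matrix

noncomputable section

namespace BSModel

/-- The unit sphere `S^{d-1} = {x ∈ ℝ^d : ‖x‖ = 1}`. -/
abbrev Sph (d : ℕ) : Type := Metric.sphere (0 : EuclideanSpace ℝ (Fin d)) 1

/-- The coordinates of a point of the sphere, as a (column) vector. -/
def vec {d : ℕ} (u : Sph d) : Fin d → ℝ := WithLp.ofLp (u : EuclideanSpace ℝ (Fin d))

/-- The surface measure on `S^{d-1}` (not normalized). -/
def surfaceMeasure (d : ℕ) : Measure (Sph d) :=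
  (volume : Measure (EuclideanSpace ℝ (Fin d))).toSphere

/-- The surface area `A_{d-1} = 2 π^{d/2} / Γ(d/2)` of `S^{d-1}`. -/
def area (d : ℕ) : ℝ := 2 * Real.pi ^ ((d : ℝ) / 2) / Real.Gamma ((d : ℝ) / 2)

/-- The density
`c(u, v) = A_{d-1}⁻² (1 - ρ²) / (1 - 2 ρ u'Qv + ρ²)^{d/2}` on `S^{d-1} × S^{d-1}`. -/
def density {d : ℕ} (ρ : ℝ) (Q : Matrix (Fin d) (Fin d) ℝ) (u v : Sph d) : ℝ :=
  1 / area d ^ 2 *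
    ((1 - ρ ^ 2) / (1 - 2 * ρ * (vec u ⬝ᵥ Q *ᵥ vec v) + ρ ^ 2) ^ ((d : ℝ) / 2))

/-- The distribution `BS_d(ρ Q)`: the measure on `S^{d-1} × S^{d-1}` with the above density
with respect to the product of the surface measures. -/
def BS {d : ℕ} (ρ : ℝ) (Q : Matrix (Fin d) (Fin d) ℝ) : Measure (Sph d × Sph d) :=
  ((surfaceMeasure d).prod (surfaceMeasure d)).withDensity
    fun p => ENNReal.ofReal (density ρ Q p.1 p.2)

variable {Ω : Type*} [MeasurableSpace Ω] {d : ℕ}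

/-- The mean vector `E(X)`, computed coordinatewise. -/
def mean (P : Measure Ω) (X : Ω → Sph d) : Fin d → ℝ :=
  fun i => ∫ ω, vec (X ω) i ∂P

/-- The matrix of second moments `E(XY')`, computed entrywise. -/
def secondMoment (P : Measure Ω) (X Y : Ω → Sph d) : Matrix (Fin d) (Fin d) ℝ :=
  Matrix.of fun i j => ∫ ω, vec (X ω) i * vec (Y ω) j ∂P

/-- The covariance matrix `Σ_{XY} = E(XY') - E(X)E(Y')`. -/
def covMatrix (P : Measure Ω) (X Y : Ω → Sph d) : Matrix (Fin d) (Fin d) ℝ :=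
  secondMoment P X Y - Matrix.vecMulVec (mean P X) (mean P Y)

/-- The matrix `Σ_{UU}⁻¹ Σ_{UV} Σ_{VV}⁻¹ Σ_{UV}'`. -/
def jwMatrix (P : Measure Ω) (U V : Ω → Sph d) : Matrix (Fin d) (Fin d) ℝ :=
  (covMatrix P U U)⁻¹ * covMatrix P U V * (covMatrix P V V)⁻¹ * (covMatrix P U V)ᵀ

/-- The set of (real) eigenvalues of a square matrix. -/
def eigenvalueSet (M : Matrix (Fin d) (Fin d) ℝ) : Set ℝ :=
  {t | Module.End.HasEigenvalue (Matrix.toLin' M) t}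

/-- The largest eigenvalue of a square matrix (meaningful when the set of eigenvalues has a
greatest element). -/
def largestEigenvalue (M : Matrix (Fin d) (Fin d) ℝ) : ℝ := sSup (eigenvalueSet M)

/-- The Johnson–Wehrly coefficient of correlation: the square root of the largest eigenvalue
of `Σ_{UU}⁻¹ Σ_{UV} Σ_{VV}⁻¹ Σ_{UV}'`. -/
def johnsonWehrly (P : Measure Ω) (U V : Ω → Sph d) : ℝ :=
  √(largestEigenvalue (jwMatrix P U V))

end BSModel

end

/-! For fixed `v`, the density is a multiple of the Poisson kernel of the ball at the interior point
`ρ w`, where `w = Qv` is a unit vector. The theorem reduces to two facts: the kernel has total mass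
independent of `ρ` and `w`, and it reproduces linear functions. The first makes both marginals
uniform; the second gives `E(U | V) = ρ Q V`, hence `E(UV') = ρ Q E(VV')`.

Both facts come from rotation invariance of the surface measure. Differentiating along one-parameter
rotation groups and summing over an orthonormal basis yields integration by parts for zonal
functions (`integral_zonal_deriv`). This gives the uniform moments directly. Write `I_p(ρ)` for the
integral of `‖u - ρ w‖^(2p)` over the sphere. Integration by parts also gives a three-term
recurrence for `I_p` (`kernelIntegral_recurrence`).

With `p = -d/2`, the functions `F = (1 - ρ²) I_p` and `G = I_{p+1}` then satisfy `ρ F' = -(p+1)(G -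
F)` and `ρ G' = (p+1)(G - F)`. So `F + G` and `ρ^(d-2) (F - G)` are constant, and the values at `0`
force both functions to equal the surface area (`kernelIntegral_eq`). The first moment along `w` is
a combination of `F` and `G`; moments orthogonal to `w` vanish by reflection.

Finally the Johnson–Wehrly matrix is `ρ² I` because `QQ' = I`. -/

namespace BSModel

open Set Metric
open scoped Pointwise RealInnerProductSpace

/-! ### Rotation invariance and integration by parts on the sphere. -/

section SphereRotation

/-- The self-map of the unit sphere induced by a linear isometry. -/
def sphereMap {E : Type*} [NormedAddCommGroup E] [InnerProductSpace ℝ E] (e : E ≃ₗᵢ[ℝ] E)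
    (u : sphere (0 : E) 1) : sphere (0 : E) 1 :=
  ⟨e u, by simp⟩

section Compact

variable {X : Type*} [TopologicalSpace X] [CompactSpace X] [MeasurableSpace X]
  [OpensMeasurableSpace X] {μ : Measure X} [IsFiniteMeasure μ]

theorem integrable_of_continuous {f : X → ℝ} (hf : Continuous f) : Integrable f μ := by
  obtain ⟨C, hC⟩ := (isCompact_range hf).isBounded.exists_norm_le
  exact Integrable.of_bound hf.aestronglyMeasurable C
    (Filter.Eventually.of_forall fun x => hC _ (mem_range_self x))

/-- Differentiation under the integral sign over a compact space. -/
theorem hasDerivAt_integral_of_continuousOn {F F' : ℝ → X → ℝ} {a b x₀ : ℝ} (hx : x₀ ∈ Ioo a b)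
    (hF : ∀ x ∈ Icc a b, Continuous (F x))
    (hF' : ContinuousOn (Function.uncurry F') (Icc a b ×ˢ univ))
    (hd : ∀ x ∈ Icc a b, ∀ u, HasDerivAt (F · u) (F' x u) x) :
    HasDerivAt (fun x => ∫ u, F x u ∂μ) (∫ u, F' x₀ u ∂μ) x₀ := by
  obtain ⟨C, hC⟩ := ((isCompact_Icc.prod isCompact_univ).image_of_continuousOn
    hF').isBounded.exists_norm_le
  have hnhds : Icc a b ∈ nhds x₀ := Icc_mem_nhds hx.1 hx.2
  have hF'c : Continuous (F' x₀) := by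
    have : Continuous fun u : X => (x₀, u) := by fun_prop
    exact hF'.comp_continuous this fun u => ⟨Ioo_subset_Icc_self hx, mem_univ u⟩
  refine (hasDerivAt_integral_of_dominated_loc_of_deriv_le (bound := fun _ => C) hnhds ?_
    (integrable_of_continuous (hF x₀ (Ioo_subset_Icc_self hx))) hF'c.aestronglyMeasurable ?_
    (integrable_const C) ?_).2
  · filter_upwards [hnhds] with x hx using (hF x hx).aestronglyMeasurable
  · exact Filter.Eventually.of_forall fun u x hx => hC _ ⟨(x, u), ⟨hx, mem_univ u⟩, rfl⟩
  · exact Filter.Eventually.of_forall fun u x hx => hd x hx u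

end Compact

variable {E : Type*} [NormedAddCommGroup E] [InnerProductSpace ℝ E]

theorem continuous_sphereMap (e : E ≃ₗᵢ[ℝ] E) : Continuous (sphereMap e) := by
  unfold sphereMap
  fun_prop

theorem inner_mem_Icc {w : E} (hw : ‖w‖ = 1) (u : sphere (0 : E) 1) :
    ⟪w, (u : E)⟫ ∈ Icc (-1 : ℝ) 1 := by
  have h := abs_real_inner_le_norm w (u : E)
  rw [hw, norm_eq_of_mem_sphere, one_mul] at h
  exact abs_le.1 h

/-- The infinitesimal rotation sending `b` to `a` and `a` to `-b`. -/
noncomputable def rotationGenerator (a b : E) : E →L[ℝ] E :=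
  InnerProductSpace.rankOne ℝ a b - InnerProductSpace.rankOne ℝ b a

theorem rotationGenerator_apply (a b x : E) :
    rotationGenerator a b x = ⟪b, x⟫ • a - ⟪a, x⟫ • b := by
  simp [rotationGenerator]

variable [FiniteDimensional ℝ E]

theorem rotationGenerator_mem_skewAdjoint (a b : E) :
    rotationGenerator a b ∈ skewAdjoint (E →L[ℝ] E) := by
  rw [skewAdjoint.mem_iff, rotationGenerator, star_sub, ContinuousLinearMap.star_eq_adjoint,
    ContinuousLinearMap.star_eq_adjoint]
  simp

/-- The one-parameter group of rotations generated by `rotationGenerator a b`. -/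
noncomputable def rotation (a b : E) (θ : ℝ) : E ≃ₗᵢ[ℝ] E :=
  letI := NormedAlgebra.restrictScalars ℚ ℝ (E →L[ℝ] E)
  Unitary.linearIsometryEquiv ⟨NormedSpace.exp (θ • rotationGenerator a b),
    NormedSpace.exp_mem_unitary_of_mem_skewAdjoint
      (skewAdjoint.smul_mem θ (rotationGenerator_mem_skewAdjoint a b))⟩

theorem rotation_apply (a b : E) (θ : ℝ) (x : E) :
    rotation a b θ x = NormedSpace.exp (θ • rotationGenerator a b) x := rfl

theorem rotation_zero_apply (a b x : E) : rotation a b 0 x = x := by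
  simp [rotation_apply]

theorem hasDerivAt_rotation (a b x : E) (θ : ℝ) :
    HasDerivAt (fun θ => rotation a b θ x) (rotationGenerator a b (rotation a b θ x)) θ := by
  simpa [rotation_apply] using (hasDerivAt_exp_smul_const' (𝕂 := ℝ) (rotationGenerator a b)
    θ).clm_apply (hasDerivAt_const θ x)

theorem continuous_rotation (a b : E) :
    Continuous fun p : ℝ × E => rotation a b p.1 p.2 := by
  have : Continuous fun θ : ℝ => NormedSpace.exp (θ • rotationGenerator a b) :=
    continuous_iff_continuousAt.2 fun θ =>
      (hasDerivAt_exp_smul_const' (𝕂 := ℝ) (rotationGenerator a b) θ).continuousAt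
  exact (this.comp continuous_fst).clm_apply continuous_snd

variable [MeasurableSpace E] [BorelSpace E]

/-- The surface measure of `s` is the dimension times the volume of the cone `(0,1) • s`; a linear
isometry carries cones to cones and preserves volume. -/
theorem measurePreserving_sphereMap (e : E ≃ₗᵢ[ℝ] E) :
    MeasurePreserving (sphereMap e) (volume : Measure E).toSphere
      (volume : Measure E).toSphere := by
  refine ⟨(continuous_sphereMap e).measurable, ?_⟩
  ext s hs
  rw [Measure.map_apply (continuous_sphereMap e).measurable hs, Measure.toSphere_apply' _ hs,
    Measure.toSphere_apply' _ ((continuous_sphereMap e).measurable hs),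
    ← e.measurePreserving.measure_preimage_emb e.toHomeomorph.measurableEmbedding
      (Ioo (0 : ℝ) 1 • (Subtype.val '' s))]
  congr 2
  ext x
  simp only [mem_smul, mem_image, mem_preimage]
  constructor
  · rintro ⟨r, hr, _, ⟨u, hu, rfl⟩, rfl⟩
    exact ⟨r, hr, _, ⟨sphereMap e u, hu, rfl⟩, by simp [sphereMap]⟩
  · rintro ⟨r, hr, _, ⟨u, hu, rfl⟩, hx⟩
    refine ⟨r, hr, _, ⟨sphereMap e.symm u, ?_, rfl⟩, ?_⟩
    · convert hu using 1
      ext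
      simp [sphereMap]
    · simp only [sphereMap]
      rw [← map_smul, hx, e.symm_apply_apply]

theorem integral_sphereMap (e : E ≃ₗᵢ[ℝ] E) {g : sphere (0 : E) 1 → ℝ} (hg : Continuous g) :
    ∫ u, g (sphereMap e u) ∂(volume : Measure E).toSphere =
      ∫ u, g u ∂(volume : Measure E).toSphere := by
  rw [← (measurePreserving_sphereMap e).map_eq,
    integral_map (continuous_sphereMap e).aemeasurable hg.aestronglyMeasurable,
    (measurePreserving_sphereMap e).map_eq]

/-- By invariance, the integral of `f ⟪w, R_θ u⟫ * ⟪b, R_θ u⟫` does not depend on `θ`; the integrand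
here is its derivative at `θ = 0`. -/
theorem integral_rotation_deriv {w a b : E} (hw : ‖w‖ = 1) {f f' : ℝ → ℝ}
    (hf : ∀ t ∈ Icc (-1 : ℝ) 1, HasDerivAt f (f' t) t) (hf' : ContinuousOn f' (Icc (-1) 1)) :
    ∫ u : sphere (0 : E) 1, f' ⟪w, (u : E)⟫ * ⟪w, rotationGenerator a b u⟫ * ⟪b, (u : E)⟫ +
      f ⟪w, (u : E)⟫ * ⟪b, rotationGenerator a b u⟫ ∂(volume : Measure E).toSphere = 0 := by
  have hfc : ContinuousOn f (Icc (-1) 1) := fun t ht => (hf t ht).continuousAt.continuousWithinAt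
  have hg : Continuous fun u : sphere (0 : E) 1 => f ⟪w, (u : E)⟫ * ⟪b, (u : E)⟫ :=
    (hfc.comp_continuous (by fun_prop) (inner_mem_Icc hw)).mul (by fun_prop)
  have hrot := continuous_rotation a b
  have key := hasDerivAt_integral_of_continuousOn (μ := (volume : Measure E).toSphere)
    (F := fun θ u => f ⟪w, rotation a b θ (u : E)⟫ * ⟪b, rotation a b θ (u : E)⟫)
    (F' := fun θ u => f' ⟪w, rotation a b θ (u : E)⟫ *
      ⟪w, rotationGenerator a b (rotation a b θ (u : E))⟫ * ⟪b, rotation a b θ (u : E)⟫ +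
      f ⟪w, rotation a b θ (u : E)⟫ * ⟪b, rotationGenerator a b (rotation a b θ (u : E))⟫)
    (a := -1) (b := 1) (x₀ := 0) (by norm_num)
    (fun θ _ => hg.comp (continuous_sphereMap (rotation a b θ))) ?_ ?_
  · have hconst : (fun θ : ℝ => ∫ u : sphere (0 : E) 1, f ⟪w, rotation a b θ (u : E)⟫ *
        ⟪b, rotation a b θ (u : E)⟫ ∂(volume : Measure E).toSphere) =
        fun _ => ∫ u : sphere (0 : E) 1, f ⟪w, (u : E)⟫ *
        ⟪b, (u : E)⟫ ∂(volume : Measure E).toSphere := by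
      funext θ
      exact integral_sphereMap (rotation a b θ) hg
    rw [hconst] at key
    simpa only [rotation_zero_apply] using key.unique (hasDerivAt_const _ _)
  · have hr : Continuous fun p : ℝ × sphere (0 : E) 1 => rotation a b p.1 (p.2 : E) :=
      hrot.comp (continuous_fst.prodMk (continuous_subtype_val.comp continuous_snd))
    have hmem : ∀ p : ℝ × sphere (0 : E) 1, ⟪w, rotation a b p.1 (p.2 : E)⟫ ∈ Icc (-1 : ℝ) 1 :=
      fun p => inner_mem_Icc hw (sphereMap (rotation a b p.1) p.2)
    have h1 := hf'.comp_continuous (f := fun p : ℝ × sphere (0 : E) 1 =>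
      ⟪w, rotation a b p.1 (p.2 : E)⟫) (by fun_prop) hmem
    have h2 := hfc.comp_continuous (f := fun p : ℝ × sphere (0 : E) 1 =>
      ⟪w, rotation a b p.1 (p.2 : E)⟫) (by fun_prop) hmem
    refine Continuous.continuousOn ?_
    refine ((h1.mul ?_).mul ?_).add (h2.mul ?_) <;> fun_prop
  · intro θ _ u
    have hw' : HasDerivAt (fun θ => ⟪w, rotation a b θ (u : E)⟫)
        ⟪w, rotationGenerator a b (rotation a b θ (u : E))⟫ θ := by
      simpa using (hasDerivAt_const θ w).inner ℝ (hasDerivAt_rotation a b (u : E) θ)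
    have hb' : HasDerivAt (fun θ => ⟪b, rotation a b θ (u : E)⟫)
        ⟪b, rotationGenerator a b (rotation a b θ (u : E))⟫ θ := by
      simpa using (hasDerivAt_const θ b).inner ℝ (hasDerivAt_rotation a b (u : E) θ)
    exact ((hf _ (inner_mem_Icc hw (sphereMap (rotation a b θ) u))).comp θ hw').mul hb'

/-- Integration by parts on the sphere for zonal functions. -/
theorem integral_zonal_deriv {w : E} (hw : ‖w‖ = 1) (a : E) {f f' : ℝ → ℝ}
    (hf : ∀ t ∈ Icc (-1 : ℝ) 1, HasDerivAt f (f' t) t) (hf' : ContinuousOn f' (Icc (-1) 1)) :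
    ∫ u : sphere (0 : E) 1, f' ⟪w, (u : E)⟫ * (⟪w, a⟫ - ⟪a, (u : E)⟫ * ⟪w, (u : E)⟫)
        ∂(volume : Measure E).toSphere =
      (Module.finrank ℝ E - 1) * ∫ u : sphere (0 : E) 1, f ⟪w, (u : E)⟫ * ⟪a, (u : E)⟫
        ∂(volume : Measure E).toSphere := by
  have hfc : ContinuousOn f (Icc (-1) 1) := fun t ht => (hf t ht).continuousAt.continuousWithinAt
  have h1 : Continuous fun u : sphere (0 : E) 1 => f' ⟪w, (u : E)⟫ :=
    hf'.comp_continuous (by fun_prop) (inner_mem_Icc hw)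
  have h2 : Continuous fun u : sphere (0 : E) 1 => f ⟪w, (u : E)⟫ :=
    hfc.comp_continuous (by fun_prop) (inner_mem_Icc hw)
  -- Summing over `b = B i` collapses the products by Parseval and `‖u‖ = 1`. The factor `finrank -
  -- 1` arises as `∑ ⟪B i, B i⟫` minus the one copy of `⟪a, u⟫` from the expansion of `a`.
  let B := stdOrthonormalBasis ℝ E
  have hsum := Finset.sum_eq_zero (s := Finset.univ) fun i _ =>
    integral_rotation_deriv (a := a) (b := B i) hw hf hf'
  have hint : ∀ i, Integrable (fun u : sphere (0 : E) 1 =>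
      f' ⟪w, (u : E)⟫ * ⟪w, rotationGenerator a (B i) u⟫ * ⟪B i, (u : E)⟫ +
      f ⟪w, (u : E)⟫ * ⟪B i, rotationGenerator a (B i) u⟫) (volume : Measure E).toSphere := by
    refine fun i => integrable_of_continuous (((h1.mul ?_).mul ?_).add (h2.mul ?_)) <;> fun_prop
  rw [← integral_finsetSum _ fun i _ => hint i] at hsum
  have hint₁ : Integrable (fun u : sphere (0 : E) 1 => f' ⟪w, (u : E)⟫ *
      (⟪w, a⟫ - ⟪a, (u : E)⟫ * ⟪w, (u : E)⟫)) (volume : Measure E).toSphere :=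
    integrable_of_continuous (h1.mul (by fun_prop))
  have hint₂ : Integrable (fun u : sphere (0 : E) 1 => f ⟪w, (u : E)⟫ * ⟪a, (u : E)⟫)
      (volume : Measure E).toSphere := integrable_of_continuous (h2.mul (by fun_prop))
  rw [← sub_eq_zero, ← integral_const_mul, ← integral_sub hint₁ (hint₂.const_mul _), ← hsum]
  congr 1
  funext u
  have hu : ∑ i, ⟪B i, (u : E)⟫ ^ 2 = 1 := by
    have := B.sum_sq_inner_right (u : E)
    rw [this, norm_eq_of_mem_sphere, one_pow]
  have hwu : ∑ i, ⟪w, B i⟫ * ⟪B i, (u : E)⟫ = ⟪w, (u : E)⟫ := B.sum_inner_mul_inner w u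
  have hau : ∑ i, ⟪a, B i⟫ * ⟪B i, (u : E)⟫ = ⟪a, (u : E)⟫ := B.sum_inner_mul_inner a u
  have hb : ∀ i, ⟪B i, B i⟫ = (1 : ℝ) := fun i => by
    rw [real_inner_self_eq_norm_sq, B.norm_eq_one, one_pow]
  have hcard : ∑ _i : Fin (Module.finrank ℝ E), (1 : ℝ) = Module.finrank ℝ E := by simp
  have hterm : ∀ i, f' ⟪w, (u : E)⟫ * ⟪w, rotationGenerator a (B i) u⟫ * ⟪B i, (u : E)⟫ +
      f ⟪w, (u : E)⟫ * ⟪B i, rotationGenerator a (B i) u⟫ =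
      f' ⟪w, (u : E)⟫ * ⟪w, a⟫ * ⟪B i, (u : E)⟫ ^ 2 -
      f' ⟪w, (u : E)⟫ * ⟪a, (u : E)⟫ * (⟪w, B i⟫ * ⟪B i, (u : E)⟫) +
      f ⟪w, (u : E)⟫ * (⟪a, B i⟫ * ⟪B i, (u : E)⟫) -
      f ⟪w, (u : E)⟫ * ⟪a, (u : E)⟫ * 1 := fun i => by
    rw [rotationGenerator_apply, inner_sub_right, inner_sub_right, inner_smul_right,
      inner_smul_right, inner_smul_right, inner_smul_right, hb, real_inner_comm a (B i)]
    ring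
  rw [Finset.sum_congr rfl fun i _ => hterm i, Finset.sum_sub_distrib, Finset.sum_add_distrib,
    Finset.sum_sub_distrib, ← Finset.mul_sum, ← Finset.mul_sum, ← Finset.mul_sum,
    ← Finset.mul_sum, hu, hwu, hau, hcard]
  ring

end SphereRotation

/-! ### Mass and first moments of the Poisson kernel. -/

section PoissonKernel

/-- The squared distance between unit vectors `u` and `ρ w` with `t = ⟪w, u⟫`. -/
def kernelBase (ρ t : ℝ) : ℝ := 1 - 2 * ρ * t + ρ ^ 2

theorem kernelBase_pos {ρ t : ℝ} (hρ : ρ ∈ Ioo (-1 : ℝ) 1) (ht : t ∈ Icc (-1 : ℝ) 1) :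
    0 < kernelBase ρ t := by
  unfold kernelBase
  rcases eq_or_ne ρ t with rfl | h
  · nlinarith [hρ.1, hρ.2]
  · have := sq_pos_of_ne_zero (sub_ne_zero.2 h)
    nlinarith [ht.1, ht.2]

theorem hasDerivAt_kernelBase_rpow_right {ρ t : ℝ} (hρ : ρ ∈ Ioo (-1 : ℝ) 1)
    (ht : t ∈ Icc (-1 : ℝ) 1) (p : ℝ) :
    HasDerivAt (fun t => kernelBase ρ t ^ p) (-(2 * ρ * p) * kernelBase ρ t ^ (p - 1)) t := by
  have h : HasDerivAt (fun t => kernelBase ρ t) (-(2 * ρ)) t := by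
    unfold kernelBase
    simpa using (((hasDerivAt_id t).const_mul (2 * ρ)).const_sub 1).add_const (ρ ^ 2)
  convert h.rpow_const (p := p) (Or.inl (kernelBase_pos hρ ht).ne') using 1
  ring

theorem hasDerivAt_kernelBase_rpow_left {ρ t : ℝ} (hρ : ρ ∈ Ioo (-1 : ℝ) 1)
    (ht : t ∈ Icc (-1 : ℝ) 1) (p : ℝ) :
    HasDerivAt (fun ρ => kernelBase ρ t ^ p)
      (p * ((2 * ρ) * kernelBase ρ t ^ (p - 1) - 2 * (kernelBase ρ t ^ (p - 1) * t))) ρ := by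
  have h : HasDerivAt (fun ρ => kernelBase ρ t) (-(2 * t) + 2 * ρ) ρ := by
    unfold kernelBase
    have h1 := (((hasDerivAt_id ρ).const_mul (2 * t)).const_sub 1).add ((hasDerivAt_id ρ).pow 2)
    refine (h1.congr_deriv (by simp)).congr_of_eventuallyEq
      (Filter.Eventually.of_forall fun x => ?_)
    simp
    ring
  convert h.rpow_const (p := p) (Or.inl (kernelBase_pos hρ ht).ne') using 1
  ring

/-- The differential equations in `ρ` are singular at `0`, so only `x * h' x` is controlled; the
mean value theorem needs `h'` only in the interior, where `x ≠ 0`. -/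
theorem eq_of_mul_deriv_eq_zero {h h' : ℝ → ℝ} {r : ℝ} (hr : 0 ≤ r)
    (hd : ∀ x ∈ Icc 0 r, HasDerivAt h (h' x) x) (h0 : ∀ x ∈ Ioo 0 r, x * h' x = 0) :
    h r = h 0 := by
  rcases hr.eq_or_lt with rfl | hr
  · rfl
  obtain ⟨c, hc, hslope⟩ := exists_hasDerivAt_eq_slope h h' hr
    (fun x hx => (hd x hx).continuousAt.continuousWithinAt)
    fun x hx => hd x (Ioo_subset_Icc_self hx)
  have hzero : h' c = 0 := (mul_eq_zero.1 (h0 c hc)).resolve_left hc.1.ne'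
  rw [hzero, eq_comm, div_eq_zero_iff, sub_eq_zero] at hslope
  exact hslope.resolve_right (by simpa using hr.ne')

variable {E : Type*} [NormedAddCommGroup E] [InnerProductSpace ℝ E]

theorem continuous_kernelBase_rpow {w : E} (hw : ‖w‖ = 1) {ρ : ℝ} (hρ : ρ ∈ Ioo (-1 : ℝ) 1)
    (p : ℝ) : Continuous fun u : sphere (0 : E) 1 => kernelBase ρ ⟪w, (u : E)⟫ ^ p := by
  refine Continuous.rpow_const ?_ fun u => Or.inl (kernelBase_pos hρ (inner_mem_Icc hw u)).ne'
  unfold kernelBase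
  fun_prop

variable [FiniteDimensional ℝ E] [MeasurableSpace E] [BorelSpace E]

/-- The integral over the sphere of a power of `‖u - ρ w‖²`. -/
noncomputable def kernelIntegral (w : E) (p ρ : ℝ) : ℝ :=
  ∫ u : sphere (0 : E) 1, kernelBase ρ ⟪w, (u : E)⟫ ^ p ∂(volume : Measure E).toSphere

/-- The first moment along `w` of a power of `‖u - ρ w‖²`. -/
noncomputable def kernelMoment (w : E) (p ρ : ℝ) : ℝ :=
  ∫ u : sphere (0 : E) 1, kernelBase ρ ⟪w, (u : E)⟫ ^ p * ⟪w, (u : E)⟫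
    ∂(volume : Measure E).toSphere

variable {w : E} {ρ : ℝ}

theorem integrable_kernelBase_rpow (hw : ‖w‖ = 1) (hρ : ρ ∈ Ioo (-1 : ℝ) 1) (p : ℝ) :
    Integrable (fun u : sphere (0 : E) 1 => kernelBase ρ ⟪w, (u : E)⟫ ^ p)
      (volume : Measure E).toSphere :=
  integrable_of_continuous (continuous_kernelBase_rpow hw hρ p)

theorem integrable_kernelBase_rpow_mul (hw : ‖w‖ = 1) (hρ : ρ ∈ Ioo (-1 : ℝ) 1) (p : ℝ)
    {g : sphere (0 : E) 1 → ℝ} (hg : Continuous g) :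
    Integrable (fun u : sphere (0 : E) 1 => kernelBase ρ ⟪w, (u : E)⟫ ^ p * g u)
      (volume : Measure E).toSphere :=
  integrable_of_continuous ((continuous_kernelBase_rpow hw hρ p).mul hg)

theorem hasDerivAt_kernelIntegral (hw : ‖w‖ = 1) (hρ : ρ ∈ Ioo (-1 : ℝ) 1) (p : ℝ) :
    HasDerivAt (kernelIntegral w p)
      (p * (2 * ρ * kernelIntegral w (p - 1) ρ - 2 * kernelMoment w (p - 1) ρ)) ρ := by
  -- A closed interval inside `(-1, 1)` keeps the base positive, so the derivative is continuous on
  -- a compact set and hence bounded.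
  obtain ⟨a, ha, ha'⟩ := exists_between hρ.1
  obtain ⟨b, hb', hb⟩ := exists_between hρ.2
  have hsub : Icc a b ⊆ Ioo (-1 : ℝ) 1 := fun x hx => ⟨ha.trans_le hx.1, hx.2.trans_lt hb⟩
  have key := hasDerivAt_integral_of_continuousOn (μ := (volume : Measure E).toSphere)
    (F := fun ρ (u : sphere (0 : E) 1) => kernelBase ρ ⟪w, (u : E)⟫ ^ p)
    (F' := fun ρ (u : sphere (0 : E) 1) =>
      p * ((2 * ρ) * kernelBase ρ ⟪w, (u : E)⟫ ^ (p - 1) -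
        2 * (kernelBase ρ ⟪w, (u : E)⟫ ^ (p - 1) * ⟪w, (u : E)⟫)))
    (a := a) (b := b) ⟨ha', hb'⟩ (fun x hx => continuous_kernelBase_rpow hw (hsub hx) p) ?_
    fun x hx u => hasDerivAt_kernelBase_rpow_left (hsub hx) (inner_mem_Icc hw u) p
  · have h1 := integrable_kernelBase_rpow hw hρ (p - 1)
    have h2 := integrable_kernelBase_rpow_mul hw hρ (p - 1)
      (g := fun u : sphere (0 : E) 1 => ⟪w, (u : E)⟫) (by fun_prop)
    rw [integral_const_mul, integral_sub (h1.const_mul _) (h2.const_mul _), integral_const_mul,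
      integral_const_mul] at key
    exact key
  · have hbase : ContinuousOn (fun q : ℝ × sphere (0 : E) 1 =>
        kernelBase q.1 ⟪w, (q.2 : E)⟫ ^ (p - 1)) (Icc a b ×ˢ univ) := by
      refine ContinuousOn.rpow_const ?_ fun q hq =>
        Or.inl (kernelBase_pos (hsub hq.1) (inner_mem_Icc hw q.2)).ne'
      unfold kernelBase
      fun_prop
    have hinner : ContinuousOn (fun q : ℝ × sphere (0 : E) 1 => ⟪w, (q.2 : E)⟫)
        (Icc a b ×ˢ univ) := by fun_prop
    exact continuousOn_const.mul (((continuousOn_const.mul continuousOn_fst).mul hbase).sub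
      (continuousOn_const.mul (hbase.mul hinner)))

/-- Since `2ρt = 1 + ρ² - kernelBase ρ t`, a factor `t` can be traded for a shift of the exponent.
-/
theorem two_mul_kernelMoment (hw : ‖w‖ = 1) (hρ : ρ ∈ Ioo (-1 : ℝ) 1) (p : ℝ) :
    2 * ρ * kernelMoment w p ρ =
      (1 + ρ ^ 2) * kernelIntegral w p ρ - kernelIntegral w (p + 1) ρ := by
  unfold kernelMoment kernelIntegral
  rw [← integral_const_mul, ← integral_const_mul,
    ← integral_sub ((integrable_kernelBase_rpow hw hρ p).const_mul _)
      (integrable_kernelBase_rpow hw hρ (p + 1))]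
  congr 1
  funext u
  rw [Real.rpow_add_one (kernelBase_pos hρ (inner_mem_Icc hw u)).ne']
  simp only [kernelBase]
  ring

/-- Integration by parts with `f = K^p` and `a = w`, multiplied by `2ρ`, where `K = kernelBase ρ t`.
The weight becomes a polynomial in `K`: `4ρ²(1 - t²) = -(1 - ρ²)² + 2(1 + ρ²)K - K²`. -/
theorem kernelIntegral_recurrence (hw : ‖w‖ = 1) (hρ : ρ ∈ Ioo (-1 : ℝ) 1) (p : ℝ) :
    -p * (-(1 - ρ ^ 2) ^ 2 * kernelIntegral w (p - 1) ρ +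
        2 * (1 + ρ ^ 2) * kernelIntegral w p ρ - kernelIntegral w (p + 1) ρ) =
      (Module.finrank ℝ E - 1) *
        ((1 + ρ ^ 2) * kernelIntegral w p ρ - kernelIntegral w (p + 1) ρ) := by
  have hcont : ContinuousOn (fun t => -(2 * ρ * p) * kernelBase ρ t ^ (p - 1)) (Icc (-1) 1) := by
    refine continuousOn_const.mul (ContinuousOn.rpow_const ?_ fun t ht =>
      Or.inl (kernelBase_pos hρ ht).ne')
    unfold kernelBase
    fun_prop
  have hparts := integral_zonal_deriv hw w
    (fun t ht => hasDerivAt_kernelBase_rpow_right hρ ht p) hcont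
  have hint := ((integrable_kernelBase_rpow hw hρ (p - 1)).const_mul (-(1 - ρ ^ 2) ^ 2)).add
    ((integrable_kernelBase_rpow hw hρ p).const_mul (2 * (1 + ρ ^ 2)))
  simp only [Pi.add_def] at hint
  rw [← two_mul_kernelMoment hw hρ p, mul_left_comm, kernelMoment, ← hparts, kernelIntegral,
    kernelIntegral, kernelIntegral, ← integral_const_mul, ← integral_const_mul,
    ← integral_const_mul,
    ← integral_add ((integrable_kernelBase_rpow hw hρ (p - 1)).const_mul _)
      ((integrable_kernelBase_rpow hw hρ p).const_mul _),
    ← integral_sub hint (integrable_kernelBase_rpow hw hρ (p + 1)), ← integral_const_mul]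
  congr 1
  funext u
  have hpos := (kernelBase_pos hρ (inner_mem_Icc hw u)).ne'
  have h1 : kernelBase ρ ⟪w, (u : E)⟫ ^ p =
      kernelBase ρ ⟪w, (u : E)⟫ ^ (p - 1) * kernelBase ρ ⟪w, (u : E)⟫ := by
    rw [← Real.rpow_add_one hpos, sub_add_cancel]
  rw [Real.rpow_add_one hpos, h1, real_inner_self_eq_norm_sq, hw]
  generalize kernelBase ρ ⟪w, (u : E)⟫ ^ (p - 1) = X
  simp only [kernelBase]
  ring

theorem kernelIntegral_zero (w : E) (p : ℝ) :
    kernelIntegral w p 0 = (volume : Measure E).toSphere.real univ := by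
  simp [kernelIntegral, kernelBase]

/-- The Poisson kernel has constant total mass. -/
theorem kernelIntegral_eq (hE : 2 ≤ Module.finrank ℝ E) (hw : ‖w‖ = 1) (hρ : ρ ∈ Ico (0 : ℝ) 1) :
    (1 - ρ ^ 2) * kernelIntegral w (-(Module.finrank ℝ E / 2)) ρ =
        (volume : Measure E).toSphere.real univ ∧
      kernelIntegral w (-(Module.finrank ℝ E / 2) + 1) ρ =
        (volume : Measure E).toSphere.real univ := by
  rcases hρ.1.eq_or_lt with rfl | hρ0
  · simp [kernelIntegral_zero]
  -- `n = d - 2 = -2(p + 1)` is the exponent of the integrating factor for `F - G`.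
  obtain ⟨n, hn⟩ := Nat.exists_eq_add_of_le' hE
  have hnR : (Module.finrank ℝ E : ℝ) = n + 2 := by rw [hn]; push_cast; ring
  set p : ℝ := -(Module.finrank ℝ E / 2) with hp
  have hsub : ∀ x ∈ Icc 0 ρ, x ∈ Ioo (-1 : ℝ) 1 := fun x hx =>
    ⟨by linarith [hx.1], hx.2.trans_lt hρ.2⟩
  have hF : ∀ x ∈ Icc 0 ρ, HasDerivAt (fun x => (1 - x ^ 2) * kernelIntegral w p x)
      (-(2 * x) * kernelIntegral w p x + (1 - x ^ 2) *
        (p * (2 * x * kernelIntegral w (p - 1) x - 2 * kernelMoment w (p - 1) x))) x := by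
    intro x hx
    refine HasDerivAt.mul ?_ (hasDerivAt_kernelIntegral hw (hsub x hx) p)
    simpa using ((hasDerivAt_id x).pow 2).const_sub 1
  have hG : ∀ x ∈ Icc 0 ρ, HasDerivAt (kernelIntegral w (p + 1))
      ((p + 1) * (2 * x * kernelIntegral w p x - 2 * kernelMoment w p x)) x := by
    intro x hx
    simpa using hasDerivAt_kernelIntegral hw (hsub x hx) (p + 1)
  have hrec : ∀ x ∈ Icc 0 ρ,
      x * (-(2 * x) * kernelIntegral w p x + (1 - x ^ 2) *
        (p * (2 * x * kernelIntegral w (p - 1) x - 2 * kernelMoment w (p - 1) x))) =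
      -(p + 1) * (kernelIntegral w (p + 1) x - (1 - x ^ 2) * kernelIntegral w p x) := by
    intro x hx
    have h1 := kernelIntegral_recurrence hw (hsub x hx) p
    have h2 := two_mul_kernelMoment hw (hsub x hx) (p - 1)
    rw [sub_add_cancel] at h2
    -- The choice `p = -d/2` is what lets the recurrence close into a system in `F` and `G` alone.
    have h3 : (Module.finrank ℝ E : ℝ) = -2 * p := by rw [hp]; ring
    rw [h3] at h1
    linear_combination -h1 - (1 - x ^ 2) * p * h2
  have hrec' : ∀ x ∈ Icc 0 ρ,
      x * ((p + 1) * (2 * x * kernelIntegral w p x - 2 * kernelMoment w p x)) =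
      (p + 1) * (kernelIntegral w (p + 1) x - (1 - x ^ 2) * kernelIntegral w p x) := by
    intro x hx
    linear_combination -(p + 1) * two_mul_kernelMoment hw (hsub x hx) p
  have hadd := eq_of_mul_deriv_eq_zero hρ.1 (fun x hx => (hF x hx).add (hG x hx)) fun x hx => by
    rw [mul_add, hrec x (Ioo_subset_Icc_self hx), hrec' x (Ioo_subset_Icc_self hx)]
    ring
  have hsubt := eq_of_mul_deriv_eq_zero hρ.1
    (fun x hx => (hasDerivAt_pow n x).mul ((hF x hx).sub (hG x hx))) fun x hx => by
    have h1 := hrec x (Ioo_subset_Icc_self hx)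
    have h2 := hrec' x (Ioo_subset_Icc_self hx)
    -- For `n = 0` the exponent `n - 1` truncates to `0`, but the factor `n` kills both sides.
    have h3 : n * x ^ (n - 1) * x = n * x ^ n := by
      cases n with
      | zero => simp
      | succ k => simp [pow_succ, mul_assoc]
    have h4 : (n : ℝ) = -2 * (p + 1) := by rw [hp, hnR]; ring
    simp only [Pi.sub_apply]
    linear_combination x ^ n * h1 - x ^ n * h2 + ((1 - x ^ 2) * kernelIntegral w p x -
      kernelIntegral w (p + 1) x) * h3 + x ^ n * ((1 - x ^ 2) * kernelIntegral w p x -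
      kernelIntegral w (p + 1) x) * h4
  simp only [Pi.add_apply, Pi.sub_apply, Pi.mul_apply, kernelIntegral_zero] at hadd hsubt
  have hne : ρ ^ n ≠ 0 := pow_ne_zero _ hρ0.ne'
  -- `F` and `G` agree at `0`, so the constant is zero even when `n = 0`, where `0 ^ n = 1`.
  have heq : (1 - ρ ^ 2) * kernelIntegral w p ρ - kernelIntegral w (p + 1) ρ = 0 := by
    refine (mul_eq_zero.1 (hsubt.trans ?_)).resolve_left hne
    ring
  constructor <;> linarith

theorem integral_inner (hE : 2 ≤ Module.finrank ℝ E) (a : E) :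
    ∫ u : sphere (0 : E) 1, ⟪a, (u : E)⟫ ∂(volume : Measure E).toSphere = 0 := by
  have : Nontrivial E := Module.nontrivial_of_finrank_pos (R := ℝ) (by omega)
  obtain ⟨w, hw⟩ := exists_norm_eq E zero_le_one
  have h := integral_zonal_deriv hw a (f := fun _ => 1) (f' := fun _ => 0)
    (fun t _ => hasDerivAt_const t 1) continuousOn_const
  simp only [zero_mul, integral_zero, one_mul, zero_eq_mul] at h
  refine h.resolve_left ?_
  have : (2 : ℝ) ≤ Module.finrank ℝ E := by exact_mod_cast hE
  linarith

/-- Integration by parts with `f t = t`: the same integral appears on both sides, with coefficients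
`-1` and `d - 1`. -/
theorem integral_inner_mul_inner {w : E} (hw : ‖w‖ = 1) (a : E) :
    Module.finrank ℝ E * ∫ u : sphere (0 : E) 1, ⟪w, (u : E)⟫ * ⟪a, (u : E)⟫
      ∂(volume : Measure E).toSphere = (volume : Measure E).toSphere.real univ * ⟪w, a⟫ := by
  have h := integral_zonal_deriv hw a (f := fun t => t) (f' := fun _ => 1)
    (fun t _ => hasDerivAt_id t) continuousOn_const
  simp only [one_mul] at h
  rw [integral_sub (integrable_const _) (integrable_of_continuous (by fun_prop)), integral_const,
    smul_eq_mul] at h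
  simp_rw [mul_comm ⟪a, _⟫] at h
  linarith

/-- Reflection in the hyperplane orthogonal to `b` fixes `w`, hence the kernel, and changes the sign
of `⟪b, u⟫`. -/
theorem integral_kernel_mul_inner_of_orthogonal {b : E} (hw : ‖w‖ = 1)
    (hρ : ρ ∈ Ioo (-1 : ℝ) 1) (p : ℝ) (hb : ⟪b, w⟫ = 0) :
    ∫ u : sphere (0 : E) 1, kernelBase ρ ⟪w, (u : E)⟫ ^ p * ⟪b, (u : E)⟫
      ∂(volume : Measure E).toSphere = 0 := by
  let R := (Submodule.span ℝ {b})ᗮ.reflection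
  have hRb : R b = -b := Submodule.reflection_orthogonalComplement_singleton_eq_neg b
  have hRw : R w = w :=
    Submodule.reflection_mem_subspace_eq_self
      (Submodule.mem_orthogonal_singleton_iff_inner_right.2 hb)
  have hwu : ∀ u : E, ⟪w, R u⟫ = ⟪w, u⟫ := fun u => by
    conv_lhs => rw [← hRw, R.inner_map_map]
  have hbu : ∀ u : E, ⟪b, R u⟫ = -⟪b, u⟫ := fun u => by
    rw [← inner_neg_left, ← hRb, ← R.inner_map_map b]
    simp [R]
  have h := integral_sphereMap R (g := fun u : sphere (0 : E) 1 =>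
    kernelBase ρ ⟪w, (u : E)⟫ ^ p * ⟪b, (u : E)⟫)
    ((continuous_kernelBase_rpow hw hρ p).mul (by fun_prop))
  simp only [sphereMap, hwu, hbu, mul_neg, integral_neg] at h
  linarith

/-- The Poisson kernel reproduces linear functions. -/
theorem integral_kernel_mul_inner (hE : 2 ≤ Module.finrank ℝ E) (hw : ‖w‖ = 1)
    (hρ : ρ ∈ Ico (0 : ℝ) 1) (a : E) :
    (1 - ρ ^ 2) * ∫ u : sphere (0 : E) 1,
        kernelBase ρ ⟪w, (u : E)⟫ ^ (-(Module.finrank ℝ E / 2) : ℝ) * ⟪a, (u : E)⟫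
        ∂(volume : Measure E).toSphere =
      (volume : Measure E).toSphere.real univ * (ρ * ⟪w, a⟫) := by
  have hρ' : ρ ∈ Ioo (-1 : ℝ) 1 := ⟨by linarith [hρ.1], hρ.2⟩
  rcases hρ.1.eq_or_lt with rfl | hρ0
  · simp [kernelBase, integral_inner hE]
  -- Only the component of `a` along `w` contributes. Its moment follows from `(1 + ρ²)F - (1 - ρ²)G
  -- = 2ρ²` times the area, after cancelling `2ρ`; hence the separate case `ρ = 0`.
  have horth : ⟪a - ⟪w, a⟫ • w, w⟫ = 0 := by
    rw [inner_sub_left, real_inner_smul_left, real_inner_self_eq_norm_sq, hw, real_inner_comm a w]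
    ring
  have h1 := integral_kernel_mul_inner_of_orthogonal hw hρ' (-(Module.finrank ℝ E / 2)) horth
  have h2 := two_mul_kernelMoment hw hρ' (-(Module.finrank ℝ E / 2))
  obtain ⟨h3, h4⟩ := kernelIntegral_eq hE hw hρ
  simp only [inner_sub_left, real_inner_smul_left, mul_sub, mul_left_comm _ ⟪w, a⟫] at h1
  rw [integral_sub (integrable_kernelBase_rpow_mul hw hρ' _ (by fun_prop))
    ((integrable_kernelBase_rpow_mul hw hρ' _ (by fun_prop)).const_mul _), integral_const_mul,
    sub_eq_zero] at h1
  rw [h1]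
  change _ * (_ * kernelMoment w _ ρ) = _
  have hne : 2 * ρ ≠ 0 := by positivity
  apply mul_left_cancel₀ hne
  linear_combination (1 - ρ ^ 2) * ⟪w, a⟫ * h2 + ⟪w, a⟫ * (1 + ρ ^ 2) * h3 -
    ⟪w, a⟫ * (1 - ρ ^ 2) * h4

end PoissonKernel

/-! ### The density: marginals and conditional mean. -/

section Distribution

variable {d : ℕ}

@[fun_prop]
theorem continuous_vec : Continuous (vec : Sph d → Fin d → ℝ) := by
  unfold vec
  fun_prop

instance : IsFiniteMeasure (surfaceMeasure d) := by
  unfold surfaceMeasure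
  infer_instance

theorem surfaceMeasure_real_univ (hd : 2 ≤ d) : (surfaceMeasure d).real univ = area d := by
  have : Nonempty (Fin d) := ⟨⟨0, by omega⟩⟩
  have hd0 : (0 : ℝ) < d / 2 := by
    positivity [show (0 : ℝ) < d by exact_mod_cast (by omega : 0 < d)]
  rw [surfaceMeasure, Measure.toSphere_real_apply_univ, measureReal_def,
    EuclideanSpace.volume_ball, area, finrank_euclideanSpace_fin, Fintype.card_fin,
    ENNReal.ofReal_one, one_pow, one_mul, ENNReal.toReal_ofReal (by positivity),
    Real.Gamma_add_one hd0.ne', Real.sqrt_eq_rpow, ← Real.rpow_natCast,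
    ← Real.rpow_mul Real.pi_pos.le]
  have := (Real.Gamma_pos_of_pos hd0).ne'
  have : (d : ℝ) ≠ 0 := by positivity
  rw [one_div_mul_eq_div]
  field_simp

theorem area_pos (hd : 2 ≤ d) : 0 < area d := by
  have hd0 : (0 : ℝ) < d / 2 := by
    positivity [show (0 : ℝ) < d by exact_mod_cast (by omega : 0 < d)]
  have := Real.Gamma_pos_of_pos hd0
  have := Real.pi_pos
  unfold area
  positivity

/-- The image of a point of the sphere under an orthogonal matrix. -/
noncomputable def rotated (Q : Matrix (Fin d) (Fin d) ℝ) (v : Sph d) : EuclideanSpace ℝ (Fin d) :=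
  WithLp.toLp 2 (Q *ᵥ vec v)

theorem rotated_apply (Q : Matrix (Fin d) (Fin d) ℝ) (v : Sph d) (i : Fin d) :
    rotated Q v i = ∑ k, Q i k * vec v k := rfl

theorem norm_rotated {Q : Matrix (Fin d) (Fin d) ℝ} (hQ : Q ∈ Matrix.orthogonalGroup (Fin d) ℝ)
    (v : Sph d) : ‖rotated Q v‖ = 1 := by
  have hv : vec v ⬝ᵥ vec v = 1 := by
    have h := real_inner_self_eq_norm_sq (v : EuclideanSpace ℝ (Fin d))
    rwa [norm_eq_of_mem_sphere, one_pow, EuclideanSpace.inner_eq_star_dotProduct] at h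
  have h : ‖rotated Q v‖ ^ 2 = 1 := by
    rw [← real_inner_self_eq_norm_sq, EuclideanSpace.inner_eq_star_dotProduct]
    change (Q *ᵥ vec v) ⬝ᵥ (Q *ᵥ vec v) = 1
    rw [Matrix.dotProduct_mulVec, Matrix.vecMul_mulVec, (Matrix.mem_orthogonalGroup_iff' _ _).1 hQ,
      Matrix.vecMul_one, hv]
  exact (pow_eq_one_iff_of_nonneg (norm_nonneg _) two_ne_zero).1 h

theorem dotProduct_mulVec_eq_inner (Q : Matrix (Fin d) (Fin d) ℝ) (u v : Sph d) :
    vec u ⬝ᵥ Q *ᵥ vec v = ⟪rotated Q v, (u : EuclideanSpace ℝ (Fin d))⟫ := by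
  rw [EuclideanSpace.inner_eq_star_dotProduct]
  rfl

/-- Exchanging the two variables replaces `Q` by its transpose, so one marginal computation serves
for both. -/
theorem density_transpose (ρ : ℝ) (Q : Matrix (Fin d) (Fin d) ℝ) (u v : Sph d) :
    density ρ Qᵀ v u = density ρ Q u v := by
  have : vec v ⬝ᵥ Qᵀ *ᵥ vec u = vec u ⬝ᵥ Q *ᵥ vec v := by
    rw [Matrix.mulVec_transpose, dotProduct_comm, ← Matrix.dotProduct_mulVec]
  rw [density, density, this]

section Orthogonal

variable {ρ : ℝ} {Q : Matrix (Fin d) (Fin d) ℝ}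

theorem transpose_mem_orthogonalGroup (hQ : Q ∈ Matrix.orthogonalGroup (Fin d) ℝ) :
    Qᵀ ∈ Matrix.orthogonalGroup (Fin d) ℝ := by
  rw [Matrix.mem_orthogonalGroup_iff, Matrix.transpose_transpose]
  exact (Matrix.mem_orthogonalGroup_iff' _ _).1 hQ

theorem kernelBase_rotated_pos (hQ : Q ∈ Matrix.orthogonalGroup (Fin d) ℝ)
    (hρ : ρ ∈ Ico (0 : ℝ) 1) (u v : Sph d) :
    0 < 1 - 2 * ρ * (vec u ⬝ᵥ Q *ᵥ vec v) + ρ ^ 2 := by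
  rw [dotProduct_mulVec_eq_inner]
  exact kernelBase_pos ⟨by linarith [hρ.1], hρ.2⟩ (inner_mem_Icc (norm_rotated hQ v) u)

theorem density_eq (hQ : Q ∈ Matrix.orthogonalGroup (Fin d) ℝ) (hρ : ρ ∈ Ico (0 : ℝ) 1)
    (u v : Sph d) :
    density ρ Q u v = 1 / area d ^ 2 * (1 - ρ ^ 2) *
      kernelBase ρ ⟪rotated Q v, (u : EuclideanSpace ℝ (Fin d))⟫ ^
        (-((Module.finrank ℝ (EuclideanSpace ℝ (Fin d)) : ℝ) / 2)) := by
  have := (kernelBase_rotated_pos hQ hρ u v).le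
  rw [dotProduct_mulVec_eq_inner] at this
  rw [density, dotProduct_mulVec_eq_inner, finrank_euclideanSpace_fin, kernelBase,
    Real.rpow_neg this]
  ring

theorem density_nonneg (hQ : Q ∈ Matrix.orthogonalGroup (Fin d) ℝ) (hρ : ρ ∈ Ico (0 : ℝ) 1)
    (u v : Sph d) : 0 ≤ density ρ Q u v := by
  have h1 := (kernelBase_rotated_pos hQ hρ u v).le
  have h2 : 0 ≤ 1 - ρ ^ 2 := by nlinarith [hρ.1, hρ.2]
  unfold density
  positivity

theorem continuous_density (hQ : Q ∈ Matrix.orthogonalGroup (Fin d) ℝ)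
    (hρ : ρ ∈ Ico (0 : ℝ) 1) : Continuous fun p : Sph d × Sph d => density ρ Q p.1 p.2 := by
  have hbase : Continuous fun p : Sph d × Sph d =>
      1 - 2 * ρ * (vec p.1 ⬝ᵥ Q *ᵥ vec p.2) + ρ ^ 2 := by
    simp only [dotProduct, Matrix.mulVec]
    fun_prop
  exact continuous_const.mul (continuous_const.div
    (hbase.rpow_const fun p => Or.inl (kernelBase_rotated_pos hQ hρ p.1 p.2).ne')
    fun p => (Real.rpow_pos_of_pos (kernelBase_rotated_pos hQ hρ p.1 p.2) _).ne')

theorem integral_density_left (hd : 2 ≤ d) (hQ : Q ∈ Matrix.orthogonalGroup (Fin d) ℝ)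
    (hρ : ρ ∈ Ico (0 : ℝ) 1) (v : Sph d) :
    ∫ u, density ρ Q u v ∂surfaceMeasure d = (area d)⁻¹ := by
  have h := (kernelIntegral_eq (by simpa using hd) (norm_rotated hQ v) hρ).1
  have hA := (area_pos hd).ne'
  simp only [density_eq hQ hρ]
  rw [integral_const_mul, mul_assoc]
  change _ * (_ * kernelIntegral _ _ _) = _
  rw [h]
  change _ * (surfaceMeasure d).real univ = _
  rw [surfaceMeasure_real_univ hd]
  field_simp

theorem integral_density_right (hd : 2 ≤ d) (hQ : Q ∈ Matrix.orthogonalGroup (Fin d) ℝ)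
    (hρ : ρ ∈ Ico (0 : ℝ) 1) (u : Sph d) :
    ∫ v, density ρ Q u v ∂surfaceMeasure d = (area d)⁻¹ := by
  simp only [← density_transpose ρ Q u]
  exact integral_density_left hd (transpose_mem_orthogonalGroup hQ) hρ u

theorem inner_single_one (i : Fin d) (u : Sph d) :
    ⟪EuclideanSpace.single i (1 : ℝ), (u : EuclideanSpace ℝ (Fin d))⟫ = vec u i := by
  simp [vec, EuclideanSpace.inner_single_left]

theorem integral_density_mul_vec (hd : 2 ≤ d) (hQ : Q ∈ Matrix.orthogonalGroup (Fin d) ℝ)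
    (hρ : ρ ∈ Ico (0 : ℝ) 1) (v : Sph d) (i : Fin d) :
    ∫ u, density ρ Q u v * vec u i ∂surfaceMeasure d =
      (area d)⁻¹ * (ρ * ∑ k, Q i k * vec v k) := by
  have h := integral_kernel_mul_inner (by simpa using hd) (norm_rotated hQ v) hρ
    (EuclideanSpace.single i (1 : ℝ))
  have hA := (area_pos hd).ne'
  simp only [inner_single_one] at h
  simp only [density_eq hQ hρ, mul_assoc (1 / area d ^ 2 * (1 - ρ ^ 2))]
  rw [integral_const_mul, mul_assoc]
  refine (congrArg _ h).trans ?_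
  change _ * ((surfaceMeasure d).real univ * _) = _
  rw [surfaceMeasure_real_univ hd, EuclideanSpace.inner_single_right, ← rotated_apply]
  simp only [one_mul, conj_trivial]
  field_simp

end Orthogonal

theorem integral_vec (hd : 2 ≤ d) (i : Fin d) : ∫ u, vec u i ∂surfaceMeasure d = 0 := by
  have h := integral_inner (E := EuclideanSpace ℝ (Fin d)) (by simpa using hd)
    (EuclideanSpace.single i (1 : ℝ))
  simp only [inner_single_one] at h
  exact h

theorem integral_vec_mul_vec (hd : 2 ≤ d) (i j : Fin d) :
    ∫ u, vec u i * vec u j ∂surfaceMeasure d =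
      area d * ((d : ℝ)⁻¹ • (1 : Matrix (Fin d) (Fin d) ℝ)) i j := by
  have h := integral_inner_mul_inner (w := EuclideanSpace.single i (1 : ℝ)) (by simp)
    (EuclideanSpace.single j (1 : ℝ))
  have hd0 : (d : ℝ) ≠ 0 := by exact_mod_cast (by omega : d ≠ 0)
  simp only [inner_single_one, finrank_euclideanSpace_fin] at h
  apply mul_left_cancel₀ hd0
  refine h.trans ?_
  change (surfaceMeasure d).real univ * _ = _
  rw [surfaceMeasure_real_univ hd, EuclideanSpace.inner_single_left]
  by_cases hij : i = j
  · subst hij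
    simp
    field_simp
  · simp [hij]

/-! ### Moments of `(U, V)`. -/

section Law

theorem integrable_density_mul {ρ : ℝ} {Q : Matrix (Fin d) (Fin d) ℝ}
    (hQ : Q ∈ Matrix.orthogonalGroup (Fin d) ℝ) (hρ : ρ ∈ Ico (0 : ℝ) 1)
    {g : Sph d × Sph d → ℝ} (hg : Continuous g) :
    Integrable (fun p : Sph d × Sph d => density ρ Q p.1 p.2 * g p)
      ((surfaceMeasure d).prod (surfaceMeasure d)) :=
  integrable_of_continuous ((continuous_density hQ hρ).mul hg)

variable {Ω : Type*} [MeasurableSpace Ω] {P : Measure Ω} {ρ : ℝ}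
  {Q : Matrix (Fin d) (Fin d) ℝ} {U V : Ω → Sph d}

/-- Existence of moments needs only compactness of the product of spheres and finiteness of `P`. -/
theorem integrable_comp_of_hasLaw [IsFiniteMeasure P]
    (hUV : HasLaw (fun ω => (U ω, V ω)) (BS ρ Q) P)
    {g : Sph d × Sph d → ℝ} (hg : Continuous g) : Integrable (fun ω => g (U ω, V ω)) P := by
  have : IsFiniteMeasure (P.map fun ω => (U ω, V ω)) := inferInstance
  exact (integrable_of_continuous (μ := P.map fun ω => (U ω, V ω)) hg).comp_aemeasurable
    hUV.aemeasurable

theorem integral_comp_of_hasLaw (hQ : Q ∈ Matrix.orthogonalGroup (Fin d) ℝ)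
    (hρ : ρ ∈ Ico (0 : ℝ) 1) (hUV : HasLaw (fun ω => (U ω, V ω)) (BS ρ Q) P)
    {g : Sph d × Sph d → ℝ} (hg : Continuous g) :
    ∫ ω, g (U ω, V ω) ∂P =
      ∫ p, density ρ Q p.1 p.2 * g p ∂(surfaceMeasure d).prod (surfaceMeasure d) := by
  refine (hUV.integral_comp hg.aestronglyMeasurable).trans ?_
  rw [BS, integral_withDensity_eq_integral_toReal_smul
    (continuous_density hQ hρ).measurable.ennreal_ofReal
    (Filter.Eventually.of_forall fun _ => ENNReal.ofReal_lt_top)]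
  simp only [ENNReal.toReal_ofReal (density_nonneg hQ hρ _ _), smul_eq_mul]

theorem integral_comp_fst (hd : 2 ≤ d) (hQ : Q ∈ Matrix.orthogonalGroup (Fin d) ℝ)
    (hρ : ρ ∈ Ico (0 : ℝ) 1) (hUV : HasLaw (fun ω => (U ω, V ω)) (BS ρ Q) P)
    {g : Sph d → ℝ} (hg : Continuous g) :
    ∫ ω, g (U ω) ∂P = (area d)⁻¹ * ∫ u, g u ∂surfaceMeasure d := by
  rw [integral_comp_of_hasLaw hQ hρ hUV (g := fun p => g p.1) (by fun_prop),
    integral_prod _ (integrable_density_mul hQ hρ (by fun_prop)),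
    ← integral_const_mul]
  simp only [integral_mul_const, integral_density_right hd hQ hρ]

theorem integral_comp_snd (hd : 2 ≤ d) (hQ : Q ∈ Matrix.orthogonalGroup (Fin d) ℝ)
    (hρ : ρ ∈ Ico (0 : ℝ) 1) (hUV : HasLaw (fun ω => (U ω, V ω)) (BS ρ Q) P)
    {g : Sph d → ℝ} (hg : Continuous g) :
    ∫ ω, g (V ω) ∂P = (area d)⁻¹ * ∫ v, g v ∂surfaceMeasure d := by
  rw [integral_comp_of_hasLaw hQ hρ hUV (g := fun p => g p.2) (by fun_prop),
    integral_prod_symm _ (integrable_density_mul hQ hρ (by fun_prop)),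
    ← integral_const_mul]
  simp only [integral_mul_const, integral_density_left hd hQ hρ]

theorem integral_vec_mul_vec_cross (hd : 2 ≤ d) (hQ : Q ∈ Matrix.orthogonalGroup (Fin d) ℝ)
    (hρ : ρ ∈ Ico (0 : ℝ) 1) (hUV : HasLaw (fun ω => (U ω, V ω)) (BS ρ Q) P) (i j : Fin d) :
    ∫ ω, vec (U ω) i * vec (V ω) j ∂P = ((d : ℝ)⁻¹ • (ρ • Q)) i j := by
  have hA := (area_pos hd).ne'
  rw [integral_comp_of_hasLaw hQ hρ hUV (g := fun p => vec p.1 i * vec p.2 j) (by fun_prop),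
    integral_prod_symm _ (integrable_density_mul hQ hρ (by fun_prop))]
  simp only [← mul_assoc]
  simp only [integral_mul_const, integral_density_mul_vec hd hQ hρ]
  -- Integrating out `u` has left the linear function `ρ (Qv)_i`; expanding it leaves second moments
  -- of the uniform distribution of `v`.
  have hterm : ∀ v : Sph d, (area d)⁻¹ * (ρ * ∑ k, Q i k * vec v k) * vec v j =
      ∑ k, (area d)⁻¹ * ρ * Q i k * (vec v k * vec v j) := fun v => by
    rw [Finset.mul_sum, Finset.mul_sum, Finset.sum_mul]
    exact Finset.sum_congr rfl fun k _ => by ring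
  simp only [hterm]
  rw [integral_finsetSum _ fun k _ => integrable_of_continuous (by fun_prop)]
  simp only [integral_const_mul, integral_vec_mul_vec hd, Matrix.smul_apply, Matrix.one_apply,
    smul_eq_mul, mul_ite, mul_one, mul_zero, Finset.sum_ite_eq', Finset.mem_univ, if_true]
  field_simp

end Law

/-- A singleton spectrum makes the supremum in `largestEigenvalue` an attained maximum. -/
theorem eigenvalueSet_smul_one (hd : 2 ≤ d) (c : ℝ) :
    eigenvalueSet (c • (1 : Matrix (Fin d) (Fin d) ℝ)) = {c} := by
  have : Nonempty (Fin d) := ⟨⟨0, by omega⟩⟩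
  ext t
  simp only [eigenvalueSet, mem_ofPred_eq, mem_singleton_iff, map_smul, Matrix.toLin'_one]
  constructor
  · intro h
    obtain ⟨x, hx⟩ := h.exists_hasEigenvector
    have h1 := hx.apply_eq_smul
    simp only [LinearMap.smul_apply, LinearMap.id_apply] at h1
    exact (smul_left_injective ℝ hx.2 h1).symm
  · rintro rfl
    obtain ⟨x, hx⟩ := exists_ne (0 : Fin d → ℝ)
    exact Module.End.hasEigenvalue_of_hasEigenvector
      (x := x) ⟨by rw [Module.End.mem_eigenspace_iff]; simp, hx⟩

theorem inv_mul_mul_inv_mul_transpose_of_orthogonal {c ρ : ℝ} (hc : c ≠ 0)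
    {Q : Matrix (Fin d) (Fin d) ℝ}
    (hQ : Q ∈ Matrix.orthogonalGroup (Fin d) ℝ) :
    (c • (1 : Matrix (Fin d) (Fin d) ℝ))⁻¹ * (c • (ρ • Q)) *
        (c • (1 : Matrix (Fin d) (Fin d) ℝ))⁻¹ * (c • (ρ • Q))ᵀ =
      ρ ^ 2 • (1 : Matrix (Fin d) (Fin d) ℝ) := by
  have hinv : (c • (1 : Matrix (Fin d) (Fin d) ℝ))⁻¹ = c⁻¹ • 1 :=
    Matrix.inv_eq_left_inv (by simp [smul_smul, hc])
  have hQQ : Q * Qᵀ = 1 := (Matrix.mem_orthogonalGroup_iff _ _).1 hQ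
  rw [hinv]
  simp only [Matrix.transpose_smul, Matrix.smul_mul, Matrix.mul_smul, one_mul, mul_one, hQQ,
    smul_smul]
  congr 1
  field_simp

end Distribution

end BSModel

theorem theorem2 {Ω : Type*} [MeasurableSpace Ω] (P : Measure Ω) [IsProbabilityMeasure P]
    (d : ℕ) (hd : 2 ≤ d) (ρ : ℝ) (hρ0 : 0 ≤ ρ) (hρ1 : ρ < 1)
    (Q : Matrix (Fin d) (Fin d) ℝ) (hQ : Q ∈ Matrix.orthogonalGroup (Fin d) ℝ)
    (U V : Ω → BSModel.Sph d)
    (hUV : HasLaw (fun ω => (U ω, V ω)) (BSModel.BS ρ Q) P) :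
    -- the moments exist
    ((∀ i, Integrable (fun ω => BSModel.vec (U ω) i) P) ∧
      (∀ i, Integrable (fun ω => BSModel.vec (V ω) i) P) ∧
      (∀ i j, Integrable (fun ω => BSModel.vec (U ω) i * BSModel.vec (U ω) j) P) ∧
      (∀ i j, Integrable (fun ω => BSModel.vec (V ω) i * BSModel.vec (V ω) j) P) ∧
      (∀ i j, Integrable (fun ω => BSModel.vec (U ω) i * BSModel.vec (V ω) j) P)) ∧
    -- and have the stated values
    BSModel.mean P U = 0 ∧
    BSModel.mean P V = 0 ∧
    BSModel.secondMoment P U U = (d : ℝ)⁻¹ • (1 : Matrix (Fin d) (Fin d) ℝ) ∧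
    BSModel.secondMoment P V V = (d : ℝ)⁻¹ • (1 : Matrix (Fin d) (Fin d) ℝ) ∧
    BSModel.secondMoment P U V = (d : ℝ)⁻¹ • (ρ • Q) ∧
    -- the Johnson–Wehrly coefficient is well defined and equals `ρ`
    IsUnit (BSModel.covMatrix P U U) ∧
    IsUnit (BSModel.covMatrix P V V) ∧
    IsGreatest (BSModel.eigenvalueSet (BSModel.jwMatrix P U V))
      (BSModel.largestEigenvalue (BSModel.jwMatrix P U V)) ∧
    BSModel.johnsonWehrly P U V = ρ := by
  have hρ : ρ ∈ Set.Ico (0 : ℝ) 1 := ⟨hρ0, hρ1⟩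
  have hd0 : (d : ℝ)⁻¹ ≠ 0 := inv_ne_zero (by exact_mod_cast (by omega : d ≠ 0))
  have hA := (BSModel.area_pos hd).ne'
  have hmU : BSModel.mean P U = 0 := funext fun i => by
    rw [BSModel.mean, BSModel.integral_comp_fst hd hQ hρ hUV (g := fun u => BSModel.vec u i)
      (by fun_prop),
      BSModel.integral_vec hd, mul_zero, Pi.zero_apply]
  have hmV : BSModel.mean P V = 0 := funext fun i => by
    rw [BSModel.mean, BSModel.integral_comp_snd hd hQ hρ hUV (g := fun u => BSModel.vec u i)
      (by fun_prop),
      BSModel.integral_vec hd, mul_zero, Pi.zero_apply]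
  have hUU : BSModel.secondMoment P U U = (d : ℝ)⁻¹ • (1 : Matrix (Fin d) (Fin d) ℝ) := by
    ext i j
    rw [BSModel.secondMoment, Matrix.of_apply,
      BSModel.integral_comp_fst hd hQ hρ hUV (g := fun u => BSModel.vec u i * BSModel.vec u j)
        (by fun_prop),
      BSModel.integral_vec_mul_vec hd, inv_mul_cancel_left₀ hA]
  have hVV : BSModel.secondMoment P V V = (d : ℝ)⁻¹ • (1 : Matrix (Fin d) (Fin d) ℝ) := by
    ext i j
    rw [BSModel.secondMoment, Matrix.of_apply,
      BSModel.integral_comp_snd hd hQ hρ hUV (g := fun u => BSModel.vec u i * BSModel.vec u j)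
        (by fun_prop),
      BSModel.integral_vec_mul_vec hd, inv_mul_cancel_left₀ hA]
  have hcross : BSModel.secondMoment P U V = (d : ℝ)⁻¹ • (ρ • Q) := by
    ext i j
    exact BSModel.integral_vec_mul_vec_cross hd hQ hρ hUV i j
  -- One vanishing mean is enough to kill the product of means.
  have hcov : ∀ X Y : Ω → BSModel.Sph d, BSModel.mean P X = 0 →
      BSModel.covMatrix P X Y = BSModel.secondMoment P X Y := by
    intro X Y hX
    rw [BSModel.covMatrix, hX, Matrix.zero_vecMulVec, sub_zero]
  have hunit : IsUnit ((d : ℝ)⁻¹ • (1 : Matrix (Fin d) (Fin d) ℝ)) :=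
    isUnit_one.smul (Units.mk0 _ hd0)
  have hjw : BSModel.eigenvalueSet (BSModel.jwMatrix P U V) = {ρ ^ 2} := by
    rw [BSModel.jwMatrix, hcov U U hmU, hcov V V hmV, hcov U V hmU, hUU, hVV, hcross,
      BSModel.inv_mul_mul_inv_mul_transpose_of_orthogonal hd0 hQ, BSModel.eigenvalueSet_smul_one hd]
  have hint : ∀ g : BSModel.Sph d × BSModel.Sph d → ℝ, Continuous g →
      Integrable (fun ω => g (U ω, V ω)) P := fun _ hg =>
    BSModel.integrable_comp_of_hasLaw hUV hg
  refine ⟨⟨fun i => hint (fun p => BSModel.vec p.1 i) (by fun_prop),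
    fun i => hint (fun p => BSModel.vec p.2 i) (by fun_prop),
    fun i j => hint (fun p => BSModel.vec p.1 i * BSModel.vec p.1 j) (by fun_prop),
    fun i j => hint (fun p => BSModel.vec p.2 i * BSModel.vec p.2 j) (by fun_prop),
    fun i j => hint (fun p => BSModel.vec p.1 i * BSModel.vec p.2 j) (by fun_prop)⟩,
    hmU, hmV, hUU, hVV, hcross, ?_, ?_, ?_, ?_⟩
  · rwa [hcov U U hmU, hUU]
  · rwa [hcov V V hmV, hVV]
  · rw [BSModel.largestEigenvalue, hjw, csSup_singleton]
    exact isGreatest_singleton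
  · rw [BSModel.johnsonWehrly, BSModel.largestEigenvalue, hjw, csSup_singleton, Real.sqrt_sq hρ0]
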